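/- Let $n\ge 0$ be an integer and $T>0$. Let $u_0:\mathbf R^n\to\mathbf R$ be Lipschitz continuous and let $H_1:\mathbf R^n\times[0,T]\times\mathbf R^n\to\mathbf R$ be continuous and satisfy, for some constants $L_1,L_2>0$: - $H_1(x,t,\lambda p)=\lambda H_1(x,t,p)$ for all $\lambda>0$ and all $x,t,p$; - $|H_1(x,t,p)-H_1(y,t,p)|\le L_1|x-y|$ for all $x,y,t$ and all $p$ with $|p|=1$; - $|H_1(x,t,p)-H_1(x,t,q)|\le L_2|p-q|$ for all $x,t,p,q$; - $|H_1(x,t,p)|$ is bounded over all $x,t$ and all $p$ with $|p|=1$. Let $w\in C(\mathbf R^n\times[0,T))$ be a viscosity solution of $w_t=H_1(x,t,\nabla w)$ in $\mathbf R^n\times(0,T)$ with $w(\cdot,0)=u_0$. Put $\Gamma_t=\{x: w(x,t)=0\}$ and $D=\{(x,t)\in\mathbf R^n\times(0,T): w(x,t)>0\}$. Assume that $\Gamma_t\neq\emptyset$ for all $t\in[0,T)$ and that $w\ge 0$ in $\mathbf R^n\times(0,T)$, so that the signed distance function to $\Gamma_t$ is $d(x,t)=\mathrm{dist}(x,\Gamma_t)\ge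 0$. Let $N_t(x)=\{z\in\Gamma_t: d(x,t)=|x-z|\}$ be the set of nearest points of $x$ on $\Gamma_t$, and let $E_t$ be the set of extinction points at time $t$, that is, of those $x\in\Gamma_t$ for which there exist $\varepsilon,\delta>0$ with $\overline{B_\varepsilon(x)}\times(t,t+\delta]\subset D$. Then: 1. $d$ is lower semicontinuous in $\mathbf R^n\times(0,T)$. 2. $d$ is continuous from below in time: for all $(x,t)\in\mathbf R^n\times(0,T)$, $$d(x,t)=\lim_{\substack{(y,s)\to(x,t)\\ s\le t}}d(y,s).$$ 3. For every $(x,t)\in\mathbf R^n\times(0,T)$, $d$ is continuous at $(x,t)$ if and only if $N_t(x)\setminus E_t\neq\emptyset$. -/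

import Mathlib

open Set Filter Topology

namespace LevelSetEvolution

/-- The space `ℝⁿ` with its Euclidean norm and inner product. -/
abbrev Space (n : ℕ) : Type := EuclideanSpace ℝ (Fin n)

/-- The standing assumptions on the Hamiltonian `H(x, t, p)` on `ℝⁿ × [0, T] × ℝⁿ`.
Values of `H` at times outside `[0, T]` are irrelevant. -/
structure IsGeometricHamiltonian {n : ℕ} (T : ℝ)
    (H : Space n → ℝ → Space n → ℝ) : Prop where
  continuousOn :
    ContinuousOn (fun q : Space n × ℝ × Space n => H q.1 q.2.1 q.2.2)
      (univ ×ˢ (Icc 0 T ×ˢ univ))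
  homogeneous : ∀ c : ℝ, 0 < c → ∀ x, ∀ t ∈ Icc 0 T, ∀ p, H x t (c • p) = c * H x t p
  lipschitz_space : ∃ L₁ : ℝ, 0 < L₁ ∧
    ∀ x y, ∀ t ∈ Icc 0 T, ∀ p, ‖p‖ = 1 → |H x t p - H y t p| ≤ L₁ * ‖x - y‖
  lipschitz_gradient : ∃ L₂ : ℝ, 0 < L₂ ∧
    ∀ x, ∀ t ∈ Icc 0 T, ∀ p q, |H x t p - H x t q| ≤ L₂ * ‖p - q‖
  bounded : ∃ M : ℝ, ∀ x, ∀ t ∈ Icc 0 T, ∀ p, ‖p‖ = 1 → |H x t p| ≤ M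

/-- `u` is a viscosity subsolution of `u_t = H(x, t, ∇u)` in `ℝⁿ × (0, T)`: whenever a `C¹`
function `φ` touches `u` from above at an interior point, `φ_t ≤ H(x, t, ∇φ)` there.
Used only for `u` and `H` continuous, so that no semicontinuous envelopes are needed. -/
def IsViscositySubsolution {n : ℕ} (T : ℝ) (H : Space n → ℝ → Space n → ℝ)
    (u : Space n → ℝ → ℝ) : Prop :=
  ∀ φ : Space n × ℝ → ℝ, ContDiffOn ℝ 1 φ (univ ×ˢ Ioo 0 T) →
    ∀ x, ∀ t ∈ Ioo 0 T,
      (∀ᶠ P in 𝓝 (x, t), u P.1 P.2 ≤ φ P) → u x t = φ (x, t) →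
        deriv (fun s => φ (x, s)) t ≤ H x t (gradient (fun y => φ (y, t)) x)

/-- `u` is a viscosity supersolution of `u_t = H(x, t, ∇u)` in `ℝⁿ × (0, T)`: whenever a `C¹`
function `φ` touches `u` from below at an interior point, `φ_t ≥ H(x, t, ∇φ)` there.
Used only for `u` and `H` continuous, so that no semicontinuous envelopes are needed. -/
def IsViscositySupersolution {n : ℕ} (T : ℝ) (H : Space n → ℝ → Space n → ℝ)
    (u : Space n → ℝ → ℝ) : Prop :=
  ∀ φ : Space n × ℝ → ℝ, ContDiffOn ℝ 1 φ (univ ×ˢ Ioo 0 T) →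
    ∀ x, ∀ t ∈ Ioo 0 T,
      (∀ᶠ P in 𝓝 (x, t), φ P ≤ u P.1 P.2) → u x t = φ (x, t) →
        H x t (gradient (fun y => φ (y, t)) x) ≤ deriv (fun s => φ (x, s)) t

/-- `w ∈ C(ℝⁿ × [0, T))` is a viscosity solution of `w_t = H(x, t, ∇w)` in `ℝⁿ × (0, T)` with
`w(·, 0) = u₀`. Values of `w` at times outside `[0, T)` are irrelevant. -/
structure IsViscositySolution {n : ℕ} (T : ℝ) (H : Space n → ℝ → Space n → ℝ)
    (u₀ : Space n → ℝ) (w : Space n → ℝ → ℝ) : Prop where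
  continuousOn : ContinuousOn (fun P : Space n × ℝ => w P.1 P.2) (univ ×ˢ Ico 0 T)
  initial : ∀ x, w x 0 = u₀ x
  subsolution : IsViscositySubsolution T H w
  supersolution : IsViscositySupersolution T H w

/-- The zero level set `Γ_t`. -/
def zeroSet {n : ℕ} (w : Space n → ℝ → ℝ) (t : ℝ) : Set (Space n) := {x | w x t = 0}

/-- The set `D_t⁺` where `w(·, t)` is positive. -/
def posSet {n : ℕ} (w : Space n → ℝ → ℝ) (t : ℝ) : Set (Space n) := {x | 0 < w x t}

/-- The set `D_t⁻` where `w(·, t)` is negative. -/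
def negSet {n : ℕ} (w : Space n → ℝ → ℝ) (t : ℝ) : Set (Space n) := {x | w x t < 0}

/-- The space-time region `D⁺`, the union of `D_t⁺ × {t}` over `t ∈ (0, T)`. -/
def posRegion {n : ℕ} (T : ℝ) (w : Space n → ℝ → ℝ) : Set (Space n × ℝ) :=
  ⋃ t ∈ Ioo 0 T, posSet w t ×ˢ {t}

/-- The space-time region `D⁻`, the union of `D_t⁻ × {t}` over `t ∈ (0, T)`. -/
def negRegion {n : ℕ} (T : ℝ) (w : Space n → ℝ → ℝ) : Set (Space n × ℝ) :=
  ⋃ t ∈ Ioo 0 T, negSet w t ×ˢ {t}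

/-- The signed distance `d(x, t)` to `Γ_t`: it is `dist(x, Γ_t)` on `D_t⁺ ∪ Γ_t` and
`-dist(x, Γ_t)` on `D_t⁻`. -/
noncomputable def signedDist {n : ℕ} (w : Space n → ℝ → ℝ) (x : Space n) (t : ℝ) : ℝ :=
  if 0 ≤ w x t then Metric.infDist x (zeroSet w t) else -Metric.infDist x (zeroSet w t)

/-- The set `E_t` of extinction points at time `t`: the points `x ∈ Γ_t` for which some
`closedBall x ε × (t, t + δ]` with `ε, δ > 0` is contained in `D⁺`. -/
def extinctionSet {n : ℕ} (T : ℝ) (w : Space n → ℝ → ℝ) (t : ℝ) : Set (Space n) :=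
  {x | x ∈ zeroSet w t ∧ ∃ ε > 0, ∃ δ > 0,
    Metric.closedBall x ε ×ˢ Ioc t (t + δ) ⊆ posRegion T w}

/-- The set `N_t(x)` of nearest points of `x` on `Γ_t`. -/
def nearestSet {n : ℕ} (w : Space n → ℝ → ℝ) (t : ℝ) (x : Space n) : Set (Space n) :=
  {z | z ∈ zeroSet w t ∧ signedDist w x t = dist x z}

end LevelSetEvolution

namespace LevelSetEvolution

variable {n : ℕ} {T : ℝ} {H : Space n → ℝ → Space n → ℝ} {u₀ : Space n → ℝ}
  {w : Space n → ℝ → ℝ}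

/-! Zeros cannot appear out of nowhere: by finite speed of propagation (`exists_zero_of_zero`, a
barrier argument), near a zero at time `t` there are zeros at all slightly earlier times. They can
vanish suddenly, and extinction points record exactly this. Lower semicontinuity is compactness:
bounded sequences of zeros accumulate at zeros (`exists_tendsto_zero`). Upper semicontinuity at `(x,
t)` follows once zeros persist near one nearest point of `x`. Towards the past this always holds.
Towards the future it holds if that point is not an extinction point; conversely, continuity makes
nearest points at later times converge to such a point. -/

/-- A geometric Hamiltonian has linear growth in the gradient variable. -/
lemma IsGeometricHamiltonian.exists_abs_le (hH : IsGeometricHamiltonian T H) :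
    ∃ M : ℝ, 0 ≤ M ∧ ∀ x, ∀ t ∈ Icc 0 T, ∀ p, |H x t p| ≤ M * ‖p‖ := by
  obtain ⟨M, hM⟩ := hH.bounded
  refine ⟨|M|, abs_nonneg M, fun x t ht p => ?_⟩
  rcases eq_or_ne p 0 with rfl | hp
  · have h := hH.homogeneous 2 two_pos x t ht 0
    rw [smul_zero] at h
    have h0 : H x t 0 = 0 := by linarith
    simp [h0]
  · have hp' : 0 < ‖p‖ := norm_pos_iff.2 hp
    have hunit : ‖(‖p‖⁻¹ • p)‖ = 1 := norm_smul_inv_norm (𝕜 := ℝ) hp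
    have h := hH.homogeneous ‖p‖ hp' x t ht (‖p‖⁻¹ • p)
    rw [smul_inv_smul₀ hp'.ne'] at h
    rw [h, abs_mul, abs_of_pos hp', mul_comm]
    exact mul_le_mul_of_nonneg_right ((hM x t ht _ hunit).trans (le_abs_self M)) hp'.le

lemma hasGradientAt_const_sub_norm_sub_sq (a c : ℝ) (z y : Space n) :
    HasGradientAt (fun x : Space n => a - c * ‖x - z‖ ^ 2) (-((2 * c) • (y - z))) y := by
  rw [hasGradientAt_iff_hasFDerivAt]
  have h := (((hasFDerivAt_id y).sub_const z).norm_sq.const_mul c).const_sub a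
  refine h.congr_fderiv ?_
  ext v
  simp
  ring

lemma nonneg_of_negRegion_eq_empty (hneg : negRegion T w = ∅) (x : Space n) {t : ℝ}
    (ht : t ∈ Ioo 0 T) : 0 ≤ w x t := by
  by_contra! h
  have : (x, t) ∈ negRegion T w := by
    simp only [negRegion, mem_iUnion]
    exact ⟨t, ht, h, rfl⟩
  simp [hneg] at this

lemma mem_posRegion {x : Space n} {t : ℝ} :
    (x, t) ∈ posRegion T w ↔ t ∈ Ioo 0 T ∧ 0 < w x t := by
  simp only [posRegion, mem_iUnion, mem_prod, mem_singleton_iff, posSet, mem_ofPred_eq]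
  constructor
  · rintro ⟨s, hs, h, rfl⟩
    exact ⟨hs, h⟩
  · rintro ⟨hs, h⟩
    exact ⟨t, hs, h, rfl⟩

lemma signedDist_eq_infDist (hneg : negRegion T w = ∅) (x : Space n) {t : ℝ}
    (ht : t ∈ Ioo 0 T) : signedDist w x t = Metric.infDist x (zeroSet w t) :=
  if_pos (nonneg_of_negRegion_eq_empty hneg x ht)

/-! ### Finite speed of propagation -/

/-- Finite speed of propagation: a zero of a nonnegative solution has zeros close to it at all
slightly earlier times, locally uniformly in time. -/
lemma IsViscositySolution.exists_zero_of_zero (hw : IsViscositySolution T H u₀ w)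
    (hH : IsGeometricHamiltonian T H) (hneg : negRegion T w = ∅)
    {r t₁ : ℝ} (hr : 0 < r) (ht₁ : t₁ < T) :
    ∃ θ > 0, ∀ z : Space n, ∀ t s, w z t = 0 → t ≤ t₁ → 0 < s → s ≤ t → t < s + θ →
      ∃ y ∈ Metric.closedBall z r, w y s = 0 := by
  obtain ⟨M, hM0, hM⟩ := hH.exists_abs_le
  have hK0 : 0 < 2 * M * r + 1 := by positivity
  -- The first bound keeps `s + θ < T`; the second makes `K = r ^ 2 / θ` exceed `2 * M * r`.
  refine ⟨min ((T - t₁) / 2) (r ^ 2 / (2 * M * r + 1)),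
    lt_min (by linarith) (by positivity), ?_⟩
  intro z t s hz htt hs hst hts
  set θ := min ((T - t₁) / 2) (r ^ 2 / (2 * M * r + 1))
  have hθ : 0 < θ := lt_min (by linarith) (by positivity)
  have hθT : s + θ < T := by
    have := min_le_left ((T - t₁) / 2) (r ^ 2 / (2 * M * r + 1))
    linarith
  obtain ⟨K, hKθ, hK⟩ : ∃ K : ℝ, K * θ = r ^ 2 ∧ 2 * M * r + 1 ≤ K := by
    refine ⟨r ^ 2 / θ, by field_simp, ?_⟩
    rw [le_div_iff₀ hθ, mul_comm]
    exact (le_div_iff₀ hK0).1 (min_le_right _ _)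
  by_contra! hpos
  have hwpos : ∀ y ∈ Metric.closedBall z r, 0 < w y s := fun y hy =>
    lt_of_le_of_ne (nonneg_of_negRegion_eq_empty hneg y ⟨hs, by linarith⟩) (hpos y hy).symm
  obtain ⟨m, hm0, hm⟩ : ∃ m > 0, ∀ y ∈ Metric.closedBall z r, m ≤ w y s := by
    have hc : ContinuousOn (fun y => w y s) (Metric.closedBall z r) :=
      hw.continuousOn.comp (f := fun y : Space n => (y, s)) (by fun_prop)
        (fun y _ => ⟨mem_univ _, hs.le, by linarith⟩)
    obtain ⟨y, hy, hmin⟩ := (isCompact_closedBall z r).exists_isMinOn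
      ⟨z, Metric.mem_closedBall_self hr.le⟩ hc
    exact ⟨w y s, hwpos y hy, fun y' hy' => hmin hy'⟩
  obtain ⟨c, hc0, hcm⟩ : ∃ c > 0, c * r ^ 2 < m :=
    ⟨m / (2 * r ^ 2), by positivity, by field_simp; norm_num⟩
  -- A sinking paraboloid: below `w` at time `s`, nonpositive on the lateral boundary and at time `s
  -- + θ`, yet positive at `(z, t)`, where `w = 0`. Hence `w - φ` has a negative minimum, attained
  -- in the interior of `Q`.
  set φ : Space n × ℝ → ℝ := fun P => c * r ^ 2 - c * ‖P.1 - z‖ ^ 2 - c * K * (P.2 - s)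
    with hφ
  have hφs : ContDiff ℝ 1 φ := by
    have : ContDiff ℝ 1 (fun P : Space n × ℝ => ‖P.1 - z‖ ^ 2) :=
      (contDiff_fst.sub contDiff_const).norm_sq ℝ
    exact (contDiff_const.sub (contDiff_const.mul this)).sub
      (contDiff_const.mul (contDiff_snd.sub contDiff_const))
  set Q : Set (Space n × ℝ) := Metric.closedBall z r ×ˢ Icc s (s + θ) with hQ
  have hQsub : Q ⊆ univ ×ˢ Ico 0 T := fun P hP =>
    ⟨mem_univ _, hs.le.trans hP.2.1, hP.2.2.trans_lt hθT⟩
  have hzQ : (z, t) ∈ Q := ⟨Metric.mem_closedBall_self hr.le, hst, hts.le⟩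
  obtain ⟨⟨y₀, t₀⟩, hP₀, hmin⟩ := ((isCompact_closedBall z r).prod isCompact_Icc).exists_isMinOn
    ⟨(z, t), hzQ⟩ ((hw.continuousOn.mono hQsub).sub hφs.continuous.continuousOn)
  have hval : w y₀ t₀ - φ (y₀, t₀) < 0 := by
    refine (hmin hzQ).trans_lt ?_
    simp only [Pi.sub_apply, hφ, hz, sub_self, norm_zero]
    have : K * (t - s) < K * θ := mul_lt_mul_of_pos_left (by linarith) (by linarith)
    nlinarith
  have hw0 : 0 ≤ w y₀ t₀ := nonneg_of_negRegion_eq_empty hneg y₀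
    ⟨hs.trans_le hP₀.2.1, hP₀.2.2.trans_lt hθT⟩
  have hφ0 : 0 < φ (y₀, t₀) := by linarith
  have hy₀ : ‖y₀ - z‖ ≤ r := by simpa [dist_eq_norm] using hP₀.1
  have hcK : 0 < c * K := mul_pos hc0 (by linarith)
  have ht₀s : s < t₀ := by
    refine lt_of_le_of_ne hP₀.2.1 ?_
    rintro rfl
    have h1 := hm y₀ hP₀.1
    have h2 : 0 ≤ c * ‖y₀ - z‖ ^ 2 := by positivity
    simp only [hφ, sub_self, mul_zero] at hval
    linarith
  have ht₀θ : t₀ < s + θ := by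
    refine lt_of_le_of_ne hP₀.2.2 ?_
    rintro rfl
    have h2 : 0 ≤ c * ‖y₀ - z‖ ^ 2 := by positivity
    have h3 : c * K * (s + θ - s) = c * r ^ 2 := by rw [← hKθ]; ring
    simp only [hφ] at hφ0
    linarith
  have hy₀r : ‖y₀ - z‖ < r := by
    refine lt_of_le_of_ne hy₀ fun h => ?_
    have h2 : 0 ≤ c * K * (t₀ - s) := mul_nonneg hcK.le (by linarith)
    simp only [hφ, h] at hφ0
    linarith
  have hnhds : Q ∈ 𝓝 (y₀, t₀) :=
    prod_mem_nhds (Metric.closedBall_mem_nhds_of_mem (by simpa [dist_eq_norm] using hy₀r))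
      (Icc_mem_nhds ht₀s ht₀θ)
  set κ := w y₀ t₀ - φ (y₀, t₀) with hκ
  have ht₀ : t₀ ∈ Ioo 0 T := ⟨hs.trans ht₀s, ht₀θ.trans hθT⟩
  have key := hw.supersolution (fun P => φ P + κ) (hφs.add contDiff_const).contDiffOn y₀ t₀ ht₀
    (by
      filter_upwards [hnhds] with P hP
      have : κ ≤ w P.1 P.2 - φ P := hmin hP
      linarith) (by simp [hκ])
  have hderiv : deriv (fun τ => φ (y₀, τ) + κ) t₀ = -(c * K) := by
    have h : HasDerivAt (fun τ => φ (y₀, τ) + κ) (-(c * K * 1)) t₀ :=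
      ((((hasDerivAt_id t₀).sub_const s).const_mul (c * K)).const_sub
        (c * r ^ 2 - c * ‖y₀ - z‖ ^ 2)).add_const κ
    rw [h.deriv, mul_one]
  have hgrad : gradient (fun y => φ (y, t₀) + κ) y₀ = -((2 * c) • (y₀ - z)) := by
    have h := hasGradientAt_const_sub_norm_sub_sq
      (c * r ^ 2 - c * K * (t₀ - s) + κ) c z y₀
    have he : (fun y => φ (y, t₀) + κ) =
        fun y : Space n => (c * r ^ 2 - c * K * (t₀ - s) + κ) - c * ‖y - z‖ ^ 2 := by
      ext y
      simp only [hφ]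
      ring
    rw [he]
    exact h.gradient
  -- The supersolution test and linear growth give `-2cMr ≤ H ≤ -cK`, against `K ≥ 2Mr + 1`.
  rw [hderiv, hgrad] at key
  have hb := (abs_le.1 (hM y₀ t₀ ⟨ht₀.1.le, ht₀.2.le⟩ (-((2 * c) • (y₀ - z))))).1
  rw [norm_neg, norm_smul, Real.norm_of_nonneg (by positivity)] at hb
  have h1 : M * (2 * c * ‖y₀ - z‖) ≤ M * (2 * c * r) := by gcongr
  have h2 : c * (2 * M * r + 1) ≤ c * K := by gcongr
  nlinarith

/-! ### Semicontinuity of the distance -/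

lemma IsViscositySolution.isClosed_zeroSet (hw : IsViscositySolution T H u₀ w) {t : ℝ}
    (ht : t ∈ Ioo 0 T) : IsClosed (zeroSet w t) := by
  have hc : Continuous (fun y => w y t) := by
    refine continuousOn_univ.1 ?_
    exact hw.continuousOn.comp (f := fun y : Space n => (y, t)) (by fun_prop)
      (fun y _ => ⟨mem_univ _, ht.1.le, ht.2⟩)
  exact isClosed_singleton.preimage hc

lemma IsViscositySolution.continuousAt (hw : IsViscositySolution T H u₀ w) (x : Space n) {t : ℝ}
    (ht : t ∈ Ioo 0 T) : ContinuousAt (fun P : Space n × ℝ => w P.1 P.2) (x, t) :=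
  hw.continuousOn.continuousAt (prod_mem_nhds univ_mem (Ico_mem_nhds ht.1 ht.2))

/-- Limits of zeros at bounded distance: if zeros of `w(·, s)` lie in a fixed ball for times
`s` accumulating at `t`, a subfamily of them converges to a zero of `w(·, t)`. -/
lemma IsViscositySolution.exists_tendsto_zero (hw : IsViscositySolution T H u₀ w) {t : ℝ}
    (ht : t ∈ Ioo 0 T) {x : Space n} {R : ℝ} {τ : ℕ → ℝ} {z : ℕ → Space n}
    (hτ : Tendsto τ atTop (𝓝 t)) (hz : ∀ k, w (z k) (τ k) = 0)
    (hR : ∀ k, dist x (z k) ≤ R) :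
    ∃ a, w a t = 0 ∧ ∃ ψ : ℕ → ℕ, StrictMono ψ ∧ Tendsto (z ∘ ψ) atTop (𝓝 a) := by
  obtain ⟨a, -, ψ, hψ, ha⟩ := (isCompact_closedBall x R).tendsto_subseq
    (fun k => by rw [Metric.mem_closedBall, dist_comm]; exact hR k)
  refine ⟨a, ?_, ψ, hψ, ha⟩
  have h := (hw.continuousAt a ht).tendsto.comp
    (ha.prodMk_nhds (hτ.comp hψ.tendsto_atTop))
  refine tendsto_nhds_unique h (tendsto_const_nhds.congr fun k => ?_)
  exact (hz (ψ k)).symm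

lemma IsViscositySolution.exists_nearest (hw : IsViscositySolution T H u₀ w)
    (hΓ : ∀ t ∈ Ico 0 T, (zeroSet w t).Nonempty) (hneg : negRegion T w = ∅) (x : Space n) {t : ℝ}
    (ht : t ∈ Ioo 0 T) : ∃ z, w z t = 0 ∧ signedDist w x t = dist x z := by
  rw [signedDist_eq_infDist hneg x ht]
  exact (hw.isClosed_zeroSet ht).exists_infDist_eq_dist (hΓ t ⟨ht.1.le, ht.2⟩) x

lemma signedDist_le_dist (hneg : negRegion T w = ∅) {x z : Space n} {t : ℝ}
    (ht : t ∈ Ioo 0 T) (hz : w z t = 0) : signedDist w x t ≤ dist x z := by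
  rw [signedDist_eq_infDist hneg x ht]
  exact Metric.infDist_le_dist_of_mem hz

lemma eventually_mem_Ioo (x : Space n) {t : ℝ} (ht : t ∈ Ioo 0 T) :
    ∀ᶠ P : Space n × ℝ in 𝓝 (x, t), P.2 ∈ Ioo 0 T :=
  continuous_snd.continuousAt.eventually (Ioo_mem_nhds ht.1 ht.2)

/-- Otherwise nearest points along a violating sequence stay bounded and subconverge to a zero at
time `t` within distance `c` of `x`. -/
lemma IsViscositySolution.eventually_lt_signedDist (hw : IsViscositySolution T H u₀ w)
    (hΓ : ∀ t ∈ Ico 0 T, (zeroSet w t).Nonempty) (hneg : negRegion T w = ∅) {x : Space n} {t : ℝ}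
    (ht : t ∈ Ioo 0 T) {c : ℝ} (hc : c < signedDist w x t) :
    ∀ᶠ P : Space n × ℝ in 𝓝 (x, t), c < signedDist w P.1 P.2 := by
  by_contra hcon
  have hfreq := (not_eventually.1 hcon).and_eventually (eventually_mem_Ioo x ht)
  obtain ⟨P, hP, hPc⟩ := exists_seq_forall_of_frequently hfreq
  choose z hz hzd using fun k => hw.exists_nearest hΓ hneg (P k).1 (hPc k).2
  have hP1 : Tendsto (fun k => (P k).1) atTop (𝓝 x) := (continuous_fst.tendsto (x, t)).comp hP
  have hP2 : Tendsto (fun k => (P k).2) atTop (𝓝 t) := (continuous_snd.tendsto (x, t)).comp hP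
  have hdist : ∀ k, dist (P k).1 (z k) ≤ c := fun k => by
    rw [← hzd k]
    exact not_lt.1 (hPc k).1
  obtain ⟨R, hR⟩ := (tendsto_const_nhds.dist hP1 : Tendsto (fun k => dist x (P k).1) atTop
    (𝓝 (dist x x))).bddAbove_range
  obtain ⟨a, ha, ψ, hψ, hlim⟩ := hw.exists_tendsto_zero (x := x) (R := R + c) ht hP2 hz
    (fun k => (dist_triangle _ (P k).1 _).trans (add_le_add (hR ⟨k, rfl⟩) (hdist k)))
  have h : dist x a ≤ c := le_of_tendsto ((hP1.comp hψ.tendsto_atTop).dist hlim)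
    (Eventually.of_forall fun k => hdist (ψ k))
  exact absurd (signedDist_le_dist hneg ht ha) (by linarith)

/-- If zeros near a nearest point `z` persist along a filter, the distance function is upper
semicontinuous along it. -/
lemma eventually_signedDist_lt (hneg : negRegion T w = ∅) {x z : Space n} {t : ℝ}
    (ht : t ∈ Ioo 0 T) {l : Filter (Space n × ℝ)} (hl : l ≤ 𝓝 (x, t))
    (hz : signedDist w x t = dist x z)
    (h : ∀ r > 0, ∀ᶠ P in l, ∃ y ∈ Metric.closedBall z r, w y P.2 = 0) {c : ℝ}
    (hc : signedDist w x t < c) : ∀ᶠ P in l, signedDist w P.1 P.2 < c := by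
  have hr : 0 < (c - signedDist w x t) / 2 := by linarith
  have hball : ∀ᶠ P : Space n × ℝ in 𝓝 (x, t), dist P.1 x < (c - signedDist w x t) / 2 :=
    (continuous_fst.tendsto (x, t)).eventually (Metric.eventually_nhds_iff.2 ⟨_, hr, fun _ h => h⟩)
  filter_upwards [h _ hr, hl hball, hl (eventually_mem_Ioo x ht)] with P ⟨y, hy, hy0⟩ hP hPt
  have h1 := signedDist_le_dist (x := P.1) hneg hPt hy0
  have h2 := dist_triangle4 P.1 x z y
  rw [Metric.mem_closedBall, dist_comm] at hy
  linarith

lemma IsViscositySolution.tendsto_signedDist_of_zero (hw : IsViscositySolution T H u₀ w)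
    (hΓ : ∀ t ∈ Ico 0 T, (zeroSet w t).Nonempty) (hneg : negRegion T w = ∅) {x z : Space n}
    {t : ℝ} (ht : t ∈ Ioo 0 T) {l : Filter (Space n × ℝ)} (hl : l ≤ 𝓝 (x, t))
    (hz : signedDist w x t = dist x z)
    (h : ∀ r > 0, ∀ᶠ P in l, ∃ y ∈ Metric.closedBall z r, w y P.2 = 0) :
    Tendsto (fun P : Space n × ℝ => signedDist w P.1 P.2) l (𝓝 (signedDist w x t)) :=
  tendsto_order.2 ⟨fun _ hc => hl (hw.eventually_lt_signedDist hΓ hneg ht hc),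
    fun _ hc => eventually_signedDist_lt hneg ht hl hz h hc⟩

/-! ### Continuity and extinction points -/

lemma IsViscositySolution.continuousAt_signedDist (hw : IsViscositySolution T H u₀ w)
    (hH : IsGeometricHamiltonian T H) (hΓ : ∀ t ∈ Ico 0 T, (zeroSet w t).Nonempty)
    (hneg : negRegion T w = ∅) {x z : Space n} {t : ℝ} (ht : t ∈ Ioo 0 T)
    (hz : z ∈ nearestSet w t x) (hzE : z ∉ extinctionSet T w t) :
    ContinuousAt (fun P : Space n × ℝ => signedDist w P.1 P.2) (x, t) := by
  refine hw.tendsto_signedDist_of_zero hΓ hneg ht le_rfl hz.2 fun r hr => ?_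
  obtain ⟨t₁, htt₁, ht₁⟩ := exists_between ht.2
  obtain ⟨θ, hθ, hback⟩ := hw.exists_zero_of_zero hH hneg (half_pos hr) ht₁
  -- Since `z` is not extinct, a zero exists near it at some `s' ∈ (t, t + δ]`. This `δ` ensures `s'
  -- ≤ t₁` and `s' - θ < t`, so propagating back from `s'` covers a neighbourhood of `t`.
  obtain ⟨δ, hδ, hδ'⟩ := exists_between (lt_min (sub_pos.2 htt₁) hθ)
  obtain ⟨hδ₁, hδθ⟩ := lt_min_iff.1 hδ'
  obtain ⟨⟨z', s'⟩, ⟨hz', hs'⟩, hnot⟩ := not_subset.1 fun hsub =>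
    hzE ⟨hz.1, r / 2, half_pos hr, δ, hδ, hsub⟩
  have hs't : t < s' := hs'.1
  have hs'δ : s' ≤ t + δ := hs'.2
  have hs'T : s' ∈ Ioo 0 T := ⟨ht.1.trans hs't, by linarith⟩
  have hzero : w z' s' = 0 := le_antisymm
    (not_lt.1 fun hlt => hnot (mem_posRegion.2 ⟨hs'T, hlt⟩))
    (nonneg_of_negRegion_eq_empty hneg z' hs'T)
  have hnear : ∀ᶠ P : Space n × ℝ in 𝓝 (x, t), P.2 ∈ Ioo (max 0 (s' - θ)) s' :=
    continuous_snd.continuousAt.eventually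
      (Ioo_mem_nhds (max_lt ht.1 (by linarith)) hs't)
  filter_upwards [hnear] with P hP
  obtain ⟨h0, h1⟩ := max_lt_iff.1 hP.1
  obtain ⟨y, hy, hy0⟩ := hback z' s' P.2 hzero (by linarith) h0 hP.2.le (by linarith)
  refine ⟨y, ?_, hy0⟩
  have := dist_triangle y z' z
  rw [Metric.mem_closedBall] at hy hz' ⊢
  linarith

/-- Nearest points of `x` at times decreasing strictly to `t` subconverge to a nearest point at time
`t`; these later zeros keep the limit from being extinct. -/
lemma IsViscositySolution.nonempty_nearestSet_diff_extinctionSet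
    (hw : IsViscositySolution T H u₀ w) (hΓ : ∀ t ∈ Ico 0 T, (zeroSet w t).Nonempty)
    (hneg : negRegion T w = ∅) {x : Space n} {t : ℝ} (ht : t ∈ Ioo 0 T)
    (hcont : ContinuousAt (fun P : Space n × ℝ => signedDist w P.1 P.2) (x, t)) :
    (nearestSet w t x \ extinctionSet T w t).Nonempty := by
  obtain ⟨τ, -, hτ, hlim⟩ := exists_seq_strictAnti_tendsto' ht.2
  have hτ0 : ∀ k, τ k ∈ Ioo 0 T := fun k => ⟨ht.1.trans (hτ k).1, (hτ k).2⟩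
  choose z hz hzd using fun k => hw.exists_nearest hΓ hneg x (hτ0 k)
  have hd : Tendsto (fun k => dist x (z k)) atTop (𝓝 (signedDist w x t)) :=
    (hcont.tendsto.comp (tendsto_const_nhds.prodMk_nhds hlim)).congr hzd
  obtain ⟨R, hR⟩ := hd.bddAbove_range
  obtain ⟨a, ha, ψ, hψ, haz⟩ := hw.exists_tendsto_zero (x := x) (R := R) ht hlim hz
    (fun k => hR ⟨k, rfl⟩)
  refine ⟨a, ⟨ha, tendsto_nhds_unique (hd.comp hψ.tendsto_atTop)
    (tendsto_const_nhds.dist haz)⟩, ?_⟩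
  rintro ⟨-, ε, hε, δ, hδ, hsub⟩
  have h1 : ∀ᶠ k in atTop, z (ψ k) ∈ Metric.closedBall a ε :=
    haz.eventually (Metric.closedBall_mem_nhds a hε)
  have h2 : ∀ᶠ k in atTop, τ (ψ k) < t + δ :=
    (hlim.comp hψ.tendsto_atTop).eventually (gt_mem_nhds (by linarith))
  obtain ⟨k, hk1, hk2⟩ := (h1.and h2).exists
  have hmem : (z (ψ k), τ (ψ k)) ∈ posRegion T w := hsub ⟨hk1, (hτ _).1, hk2.le⟩
  exact (mem_posRegion.1 hmem).2.ne' (hz _)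

lemma IsViscositySolution.tendsto_signedDist_of_le (hw : IsViscositySolution T H u₀ w)
    (hH : IsGeometricHamiltonian T H) (hΓ : ∀ t ∈ Ico 0 T, (zeroSet w t).Nonempty)
    (hneg : negRegion T w = ∅) (x : Space n) {t : ℝ} (ht : t ∈ Ioo 0 T) :
    Tendsto (fun P : Space n × ℝ => signedDist w P.1 P.2)
      (𝓝[{P | P.2 ∈ Ioo 0 T ∧ P.2 ≤ t}] (x, t)) (𝓝 (signedDist w x t)) := by
  obtain ⟨z, hz, hzd⟩ := hw.exists_nearest hΓ hneg x ht
  refine hw.tendsto_signedDist_of_zero hΓ hneg ht nhdsWithin_le_nhds hzd fun r hr => ?_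
  obtain ⟨θ, hθ, hback⟩ := hw.exists_zero_of_zero hH hneg hr ht.2
  have hnear : ∀ᶠ P : Space n × ℝ in 𝓝 (x, t), t - θ < P.2 :=
    continuous_snd.continuousAt.eventually (lt_mem_nhds (by linarith))
  filter_upwards [self_mem_nhdsWithin, nhdsWithin_le_nhds hnear] with P hP hPθ
  exact hback z t P.2 hz le_rfl hP.1.1 hP.2 (by linarith)

end LevelSetEvolution

theorem theorem5p4 {n : ℕ} {T : ℝ} (hT : 0 < T)
    (u₀ : LevelSetEvolution.Space n → ℝ) (hu₀ : ∃ L₀, LipschitzWith L₀ u₀)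
    (H₁ : LevelSetEvolution.Space n → ℝ → LevelSetEvolution.Space n → ℝ)
    (hH₁ : LevelSetEvolution.IsGeometricHamiltonian T H₁)
    (w : LevelSetEvolution.Space n → ℝ → ℝ)
    (hw : LevelSetEvolution.IsViscositySolution T H₁ u₀ w)
    (hΓ : ∀ t ∈ Ico 0 T, (LevelSetEvolution.zeroSet w t).Nonempty)
    (hneg : LevelSetEvolution.negRegion T w = ∅) :
    LowerSemicontinuousOn
        (fun P : LevelSetEvolution.Space n × ℝ => LevelSetEvolution.signedDist w P.1 P.2)
        (univ ×ˢ Ioo 0 T) ∧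
      (∀ x : LevelSetEvolution.Space n, ∀ t ∈ Ioo 0 T,
        Tendsto
          (fun P : LevelSetEvolution.Space n × ℝ => LevelSetEvolution.signedDist w P.1 P.2)
          (𝓝[{P | P.2 ∈ Ioo 0 T ∧ P.2 ≤ t}] (x, t))
          (𝓝 (LevelSetEvolution.signedDist w x t))) ∧
      (∀ x : LevelSetEvolution.Space n, ∀ t ∈ Ioo 0 T,
        (ContinuousAt
            (fun P : LevelSetEvolution.Space n × ℝ => LevelSetEvolution.signedDist w P.1 P.2)
            (x, t) ↔
          (LevelSetEvolution.nearestSet w t x \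
            LevelSetEvolution.extinctionSet T w t).Nonempty)) := by
  refine ⟨fun P hP c hc => nhdsWithin_le_nhds (hw.eventually_lt_signedDist hΓ hneg hP.2 hc),
    fun x t ht => hw.tendsto_signedDist_of_le hH₁ hΓ hneg x ht, fun x t ht =>
    ⟨hw.nonempty_nearestSet_diff_extinctionSet hΓ hneg ht, ?_⟩⟩
  rintro ⟨z, hz, hzE⟩
  exact hw.continuousAt_signedDist hH₁ hΓ hneg ht hz hzE
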